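/- Let $X$ be a random variable with values in an alphabet $\mathcal X=\{x_1,\dots,x_n\}$ of $n$ elements, and let $p_1\ge p_2\ge\dots\ge p_n\ge 0$ be the probabilities $P\{X=x\}$, $x\in\mathcal X$, listed in non-increasing order; write $\mathbf p=(p_1,\dots,p_n)$. Let $2\le m<n$, let $\mathcal Y_m$ be a set of $m$ elements, and let $\mathcal F_m$ be the set of all surjective functions $f:\mathcal X\to\mathcal Y_m$. Let $\log$ be the logarithm in base $2$ and $\ln$ the natural logarithm. For a probability vector $\mathbf a=(a_1,\dots,a_t)$ put $H(\mathbf a)=-\sum_i a_i\log a_i$ (with $0\log 0=0$), and for a random variable $Z$ with finitely many values let $H(Z)$ be $H$ of its distribution. Define $R_m(\mathbf p)=(r_1,\dots,r_m)$ as follows. If $p_1<1/m$, then $r_i=1/m$ for all $i$. If $p_1\ge 1/m$, let $i^*$ be the largest index $i\in\{1,\dots,m-1\}$ such that $p_i\ge\frac{1}{m-i}\sum_{j=i+1}^n p_j$ (the index $i=1$ satisfies this), and put $$r_i=\begin{cases}p_i & \text{for } i=1,\dots,i^*,\\ \dfrac{1}{m-i^*}\displaystyle\sum_{j=i^*+1}^n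 p_j & \text{for } i=i^*+1,\dots,m.\end{cases}$$ Define $Q_m(\mathbf p)=(q_1,\dots,q_m)$ by $q_1=\sum_{k=1}^{n-m+1}p_k$ and $q_i=p_{n-m+i}$ for $i=2,\dots,m$. Then $$\max_{f\in\mathcal F_m}H(f(X))\in\bigl[H(R_m(\mathbf p))-\alpha,\;H(R_m(\mathbf p))\bigr],\qquad \alpha=1-\frac{1+\ln(\ln 2)}{\ln 2}<0.0861,$$ and $$\min_{f\in\mathcal F_m}H(f(X))=H(Q_m(\mathbf p)).$$ -/

import Mathlib

noncomputable section

namespace EntropyOfFunction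

/-- Shannon entropy in bits of a finite family of masses; `Real.logb 2 0 = 0`, so a zero mass
contributes `0`. -/
def entropy {ι : Type*} [Fintype ι] (a : ι → ℝ) : ℝ :=
  -∑ i, a i * Real.logb 2 (a i)

/-- The probability mass function of a finite-valued random variable `Z`. -/
def law {Ω : Type*} [MeasurableSpace Ω] (P : MeasureTheory.Measure Ω) {E : Type*} (Z : Ω → E) :
    E → ℝ :=
  fun e => P.real (Z ⁻¹' {e})

/-- The non-increasing rearrangement of a vector. -/
def decr {n : ℕ} (p : Fin n → ℝ) : Fin n → ℝ :=
  p ∘ Tuple.sort (OrderDual.toDual ∘ p)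

theorem decr_antitone {n : ℕ} (p : Fin n → ℝ) : Antitone (decr p) :=
  fun _ _ h => Tuple.monotone_sort (OrderDual.toDual ∘ p) h

/-- The coordinate `p_i` with indices starting from `1`, for `1 ≤ i ≤ n`
(and `0` for other `i`). -/
def coord {n : ℕ} (p : Fin n → ℝ) (i : ℕ) : ℝ :=
  if h : 1 ≤ i ∧ i ≤ n then p ⟨i - 1, by omega⟩ else 0

/-- The tail sum `p_{i+1} + ⋯ + p_n`. -/
def tailSum {n : ℕ} (p : Fin n → ℝ) (i : ℕ) : ℝ :=
  ∑ j ∈ Finset.Icc (i + 1) n, coord p j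

/-- The largest index `i ∈ {1, …, m - 1}` with `p_i ≥ (p_{i+1} + ⋯ + p_n) / (m - i)`
(and `0` if there is none). -/
def cutIndex (m : ℕ) {n : ℕ} (p : Fin n → ℝ) : ℕ :=
  Nat.findGreatest (fun i => tailSum p i / ((m : ℝ) - (i : ℝ)) ≤ coord p i) (m - 1)

/-- The flattening operator `R_m` on a non-increasing probability vector `p`. The component with
1-based index `i` of the result stands at position `i - 1` of `Fin m`. -/
def flatten (m : ℕ) {n : ℕ} (p : Fin n → ℝ) : Fin m → ℝ := fun k =>
  if coord p 1 < 1 / (m : ℝ) then 1 / (m : ℝ)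
  else if (k : ℕ) + 1 ≤ cutIndex m p then coord p (k + 1)
  else tailSum p (cutIndex m p) / ((m : ℝ) - (cutIndex m p : ℝ))

/-- The operator `Q_m` on a non-increasing probability vector `p`: the first component is
`p_1 + ⋯ + p_{n-m+1}`, and the `i`-th one is `p_{n-m+i}` for `i = 2, …, m`. -/
def mergeTop (m : ℕ) {n : ℕ} (p : Fin n → ℝ) : Fin m → ℝ := fun k =>
  if (k : ℕ) = 0 then ∑ j ∈ Finset.Icc 1 (n - m + 1), coord p j
  else coord p (n - m + (k + 1))

/-- The constant `1 - (1 + ln ln 2) / ln 2`. -/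
def alpha : ℝ := 1 - (1 + Real.log (Real.log 2)) / Real.log 2

/-- The values `H(f(X))`, where `f` ranges over the surjections from `E` onto `F`. -/
def imageEntropies {Ω : Type*} [MeasurableSpace Ω] (P : MeasureTheory.Measure Ω)
    {E : Type*} (X : Ω → E) (F : Type*) [Fintype F] : Set ℝ :=
  {h | ∃ f : E → F, Function.Surjective f ∧ h = entropy (law P (f ∘ X))}

end EntropyOfFunction

end

/-!
Everything rests on Gibbs' inequality `-∑ a log a ≤ -∑ a log b` for `∑ b ≤ ∑ a`.

Let `c` be the common value of the last components of `R_m(p)`. Then `∑ min(p_i, c) = m c`, so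
`∑ (p_i - c)⁺ = ∑ p_i - m c`, and `H(R_m(p)) = -∑ p_i log max(p_i, c)`.

Upper bound for the maximum: let `a_y` be the heaviest atom of the fibre of `y`. The vector
`max(p_{a_y}, c)` has total mass at most `1`, and Gibbs' inequality against it bounds `H(f(X))` by
`H(R_m(p))`.

Lower bound: in an entropy maximizing image `q`, a fibre more than twice as heavy as the lightest
one contains a single atom, since otherwise moving an atom of it to the lightest fibre would
increase the entropy. Let `u` be `q` with the remaining entries, which all lie in some `[y, 2y]`,
replaced by their average. Gibbs' inequality in relative form gives `H(R_m(p)) ≤ -∑ q log u`, and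
the averaging costs at most `α` bits: compare the chord of `-t log t` over `[y, 2y]` with a tangent
of the logarithm.

Minimum: if both vectors are sorted, every component of `Q_m(p)` but the first is at most the
corresponding component of the image `q`. So `q` arises from `Q_m(p)` by moving mass out of the
first component only, which remains the largest one, and by Gibbs' inequality this does not
decrease the entropy.
-/

namespace EntropyOfFunction

open Finset Function Real

/-! ### Inequalities for logarithms -/

section Gibbs

variable {ι : Type*} [Fintype ι]

/-- Gibbs' inequality in relative form: `∑ p log (v / w) ≤ ∑ p (v / w - 1)`. -/
theorem sum_mul_log_le_sum_mul_log {p v w : ι → ℝ} (hp : ∀ i, 0 ≤ p i)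
    (hv : ∀ i, 0 < p i → 0 < v i) (hw : ∀ i, 0 < p i → 0 < w i)
    (h : ∑ i, p i * (v i / w i) ≤ ∑ i, p i) :
    ∑ i, p i * log (v i) ≤ ∑ i, p i * log (w i) := by
  have key : ∀ i, p i * log (v i) - p i * log (w i) ≤ p i * (v i / w i) - p i := fun i => by
    rcases (hp i).eq_or_lt with h0 | h0
    · simp [← h0]
    · rw [← mul_sub, ← log_div (hv i h0).ne' (hw i h0).ne', ← mul_sub_one]
      exact mul_le_mul_of_nonneg_left (log_le_sub_one_of_pos (div_pos (hv i h0) (hw i h0))) h0.le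
  have hsum := sum_le_sum fun i (_ : i ∈ univ) => key i
  simp only [sum_sub_distrib] at hsum
  linarith

theorem sum_negMulLog_le_neg_sum_mul_log {a b : ι → ℝ} (ha : ∀ i, 0 ≤ a i) (hb : ∀ i, 0 ≤ b i)
    (hab : ∀ i, 0 < a i → 0 < b i) (h : ∑ i, b i ≤ ∑ i, a i) :
    ∑ i, negMulLog (a i) ≤ -∑ i, a i * log (b i) := by
  have hmul : ∀ i, a i * (b i / a i) ≤ b i := fun i => by
    rcases (ha i).eq_or_lt with h0 | h0
    · simpa [← h0] using hb i
    · rw [mul_div_cancel₀ _ h0.ne']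
  simp only [negMulLog, neg_mul, sum_neg_distrib, neg_le_neg_iff]
  exact sum_mul_log_le_sum_mul_log ha hab (fun _ => id) ((sum_le_sum fun i _ => hmul i).trans h)

/-- Passing from `Q` to `q` takes mass away only from the index `k₀`, and `q k₀` is still the
largest mass afterwards. -/
theorem sum_negMulLog_le_of_le_of_ne {q Q : ι → ℝ} {k₀ : ι} (hq : ∀ k, 0 ≤ q k)
    (hQ : ∀ k, 0 ≤ Q k) (hmax : ∀ k, q k ≤ q k₀) (hle : ∀ k ≠ k₀, Q k ≤ q k)
    (hsum : ∑ k, Q k = ∑ k, q k) :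
    ∑ k, negMulLog (Q k) ≤ ∑ k, negMulLog (q k) := by
  have hpos : ∀ k, 0 < Q k → 0 < q k := by
    intro k hk
    by_contra! hqk
    rcases eq_or_ne k k₀ with rfl | hne
    · have : ∑ k, q k ≤ 0 := sum_nonpos fun j _ => (hmax j).trans hqk
      linarith [single_le_sum (fun j _ => hQ j) (mem_univ k)]
    · linarith [hle k hne]
  have hterm : ∀ k, (q k - Q k) * log (q k) ≤ (q k - Q k) * log (q k₀) := by
    intro k
    rcases eq_or_ne k k₀ with rfl | hne
    · rfl
    rcases (hq k).eq_or_lt with h0 | h0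
    · have : Q k = 0 := le_antisymm (by linarith [hle k hne]) (hQ k)
      simp [← h0, this]
    · exact mul_le_mul_of_nonneg_left (log_le_log h0 (hmax k)) (sub_nonneg.2 (hle k hne))
  have hcross : ∑ k, (q k - Q k) * log (q k) ≤ 0 :=
    (sum_le_sum fun k _ => hterm k).trans_eq (by rw [← sum_mul, sum_sub_distrib, hsum]; ring)
  have hgibbs := sum_negMulLog_le_neg_sum_mul_log hQ hq hpos hsum.ge
  simp only [sub_mul, sum_sub_distrib] at hcross
  simp only [negMulLog, neg_mul, sum_neg_distrib] at hgibbs ⊢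
  linarith

end Gibbs

theorem add_lt_add_of_strictConcaveOn {s : Set ℝ} {φ : ℝ → ℝ}
    (hφ : StrictConcaveOn ℝ s φ) {x z e : ℝ} (hx : x ∈ s) (hz : z ∈ s) (he : 0 < e)
    (h : z + e < x) : φ x + φ z < φ (x - e) + φ (z + e) := by
  have hd : 0 < x - z := by linarith
  have hfrac : e / (x - z) < 1 := (div_lt_one hd).2 (by linarith)
  have hlow := hφ.2 hx hz (by linarith : z < x).ne' (div_pos he hd) (sub_pos.2 hfrac) (by ring)
  have hhigh := hφ.2 hx hz (by linarith : z < x).ne' (sub_pos.2 hfrac) (div_pos he hd) (by ring)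
  have elow : e / (x - z) * x + (1 - e / (x - z)) * z = z + e := by field_simp; ring
  have ehigh : (1 - e / (x - z)) * x + e / (x - z) * z = x - e := by field_simp; ring
  simp only [smul_eq_mul, elow] at hlow
  simp only [smul_eq_mul, ehigh] at hhigh
  linarith

theorem chord_le_negMulLog {y t : ℝ} (hy : 0 < y) (hyt : y ≤ t) (hty : t ≤ 2 * y) :
    -(t * log y) - 2 * (t - y) * log 2 ≤ negMulLog t := by
  have hconc := concaveOn_negMulLog.2 (Set.mem_Ici.2 hy.le)
    (Set.mem_Ici.2 (by linarith : 0 ≤ 2 * y)) (sub_nonneg.2 ((div_le_iff₀ hy).2 hty))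
    (sub_nonneg.2 ((one_le_div hy).2 hyt)) (by ring)
  have ht : (2 - t / y) • y + (t / y - 1) • (2 * y) = t := by
    simp only [smul_eq_mul]; field_simp; ring
  rw [ht] at hconc
  refine le_of_eq_of_le ?_ hconc
  simp only [smul_eq_mul, negMulLog, log_mul two_ne_zero hy.ne']
  field_simp
  ring

/-! ### The constant `alpha` -/

theorem alpha_lt : alpha < 0.0861 := by
  have hlow := log_two_gt_d9
  have hupp := log_two_lt_d9
  have hpos : 0 < log 2 := log_pos one_lt_two
  have hexp : (1.442698 : ℝ) ≤ exp 0.366532 := by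
    refine le_trans ?_ (sum_le_exp_of_nonneg (x := 0.366532) (by norm_num) 7)
    norm_num [sum_range_succ, Nat.factorial]
  have hinv : (log 2)⁻¹ ≤ exp 0.366532 := by
    refine le_trans ?_ hexp
    rw [inv_le_comm₀ hpos (by norm_num)]
    exact le_trans (by norm_num) hlow.le
  have hloglog : -0.366532 ≤ log (log 2) := by
    have h := log_le_log (inv_pos.2 hpos) hinv
    rw [log_exp, log_inv] at h
    linarith
  have hdiv : 0.9139 < (1 + log (log 2)) / log 2 := by
    rw [lt_div_iff₀ hpos]
    linarith
  rw [alpha]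
  linarith

/-- This is the tangent line of `log` at `1 / (2 * log 2)`. -/
theorem log_add_two_mul_one_sub_mul_log_two_le {u : ℝ} (hu : 0 < u) :
    log u + 2 * (1 - u) * log 2 ≤ alpha * log 2 := by
  have hlog : 0 < log 2 := log_pos one_lt_two
  have htangent := log_le_sub_one_of_pos (mul_pos (mul_pos two_pos hlog) hu)
  rw [log_mul (mul_pos two_pos hlog).ne' hu.ne', log_mul two_ne_zero hlog.ne'] at htangent
  have halpha : alpha * log 2 = log 2 - 1 - log (log 2) := by
    rw [alpha]
    field_simp
    ring
  linarith

theorem alpha_mul_log_two_nonneg : 0 ≤ alpha * log 2 := by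
  simpa using log_add_two_mul_one_sub_mul_log_two_le one_pos

theorem neg_sum_mul_log_average_le {κ : Type*} {s : Finset κ} {q : κ → ℝ} {y : ℝ}
    (hyq : ∀ a ∈ s, y ≤ q a) (hqy : ∀ a ∈ s, q a ≤ 2 * y) :
    -((∑ a ∈ s, q a) * log ((∑ a ∈ s, q a) / #s)) ≤
      ∑ a ∈ s, negMulLog (q a) + (∑ a ∈ s, q a) * (alpha * log 2) := by
  rcases s.eq_empty_or_nonempty with rfl | hs
  · simp
  have hy0 : 0 ≤ y := by
    obtain ⟨a, ha⟩ := hs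
    linarith [hyq a ha, hqy a ha]
  rcases hy0.eq_or_lt with rfl | hy
  · have hq : ∀ a ∈ s, q a = 0 := fun a ha => le_antisymm (by simpa using hqy a ha) (hyq a ha)
    simp [sum_eq_zero hq, sum_eq_zero fun a ha => (congrArg negMulLog (hq a ha)).trans
      negMulLog_zero]
  have hN : (0 : ℝ) < #s := by exact_mod_cast hs.card_pos
  have hchord : -((∑ a ∈ s, q a) * log y) - 2 * (∑ a ∈ s, q a - #s * y) * log 2 ≤
      ∑ a ∈ s, negMulLog (q a) := by
    refine le_of_eq_of_le ?_
      (sum_le_sum fun a ha => chord_le_negMulLog hy (hyq a ha) (hqy a ha))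
    simp only [sum_sub_distrib, sum_neg_distrib, ← sum_mul, ← mul_sum, sum_const, nsmul_eq_mul]
  have hS : 0 < ∑ a ∈ s, q a := sum_pos (fun a ha => hy.trans_le (hyq a ha)) hs
  set S := ∑ a ∈ s, q a
  have hA : 0 < S / #s := div_pos hS hN
  have hgap := mul_le_mul_of_nonneg_left
    (log_add_two_mul_one_sub_mul_log_two_le (div_pos hy hA)) hS.le
  have hgap_eq : S * (log (y / (S / #s)) + 2 * (1 - y / (S / #s)) * log 2) =
      S * log y - S * log (S / #s) + 2 * (S - #s * y) * log 2 := by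
    rw [log_div hy.ne' hA.ne']
    field_simp
  linarith

/-- The vector `q` with its entries on `s` replaced by their average. It is the comparison vector
in the lower bound for the maximal entropy, where `s` is the set of light images. -/
noncomputable def averageOn {κ : Type*} [DecidableEq κ] (s : Finset κ) (q : κ → ℝ) (a : κ) : ℝ :=
  if a ∈ s then (∑ j ∈ s, q j) / #s else q a

section AverageOn

variable {κ : Type*} [Fintype κ] [DecidableEq κ] {q : κ → ℝ}

theorem sum_averageOn (s : Finset κ) (q : κ → ℝ) : ∑ a, averageOn s q a = ∑ a, q a := by
  have hs : (#s : ℝ) * ((∑ j ∈ s, q j) / #s) = ∑ j ∈ s, q j := by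
    rcases s.eq_empty_or_nonempty with rfl | hs
    · simp
    · exact mul_div_cancel₀ _ (Nat.cast_ne_zero.2 hs.card_ne_zero)
  simp only [averageOn, sum_ite, sum_const, nsmul_eq_mul, filter_mem_eq_inter, univ_inter, hs]
  rw [← sum_filter_add_sum_filter_not univ (· ∈ s) q, filter_mem_eq_inter, univ_inter]

theorem neg_sum_mul_log_averageOn_le (hq : ∀ a, 0 ≤ q a) {s : Finset κ} {y : ℝ}
    (hyq : ∀ a ∈ s, y ≤ q a) (hqy : ∀ a ∈ s, q a ≤ 2 * y) :
    -∑ a, q a * log (averageOn s q a) ≤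
      ∑ a, negMulLog (q a) + (∑ a, q a) * (alpha * log 2) := by
  have hlight := neg_sum_mul_log_average_le hyq hqy
  have hcost : (∑ a ∈ s, q a) * (alpha * log 2) ≤ (∑ a, q a) * (alpha * log 2) :=
    mul_le_mul_of_nonneg_right (sum_le_univ_sum_of_nonneg hq) alpha_mul_log_two_nonneg
  have hcross : ∑ a, q a * log (averageOn s q a) =
      (∑ a ∈ s, q a) * log ((∑ a ∈ s, q a) / #s) + ∑ a ∈ sᶜ, q a * log (q a) := by
    rw [← sum_add_sum_compl s, sum_mul]
    congr 1
    · exact sum_congr rfl fun a ha => by rw [averageOn, if_pos ha]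
    · exact sum_congr rfl fun a ha => by rw [averageOn, if_neg (mem_compl.1 ha)]
  rw [← sum_add_sum_compl s fun a => negMulLog (q a), hcross]
  simp only [negMulLog, neg_mul, sum_neg_distrib] at hlight ⊢
  linarith

/-- The set `s` consists of the entries that are at most twice the least one, `q b`. -/
theorem exists_averageOn_light [Nonempty κ] (hq : ∀ a, 0 ≤ q a) :
    ∃ (b : κ) (s : Finset κ) (A : ℝ), 0 ≤ A ∧ (∀ a, A ≤ averageOn s q a) ∧
      (∀ a, A < averageOn s q a → 2 * q b < q a) ∧ (∀ a, 0 < q a → 0 < averageOn s q a) ∧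
      -∑ a, q a * log (averageOn s q a) ≤
        ∑ a, negMulLog (q a) + (∑ a, q a) * (alpha * log 2) := by
  obtain ⟨b, hb⟩ := Finite.exists_min q
  set s : Finset κ := {a | q a ≤ 2 * q b} with hs
  have hmem : ∀ a, a ∈ s ↔ q a ≤ 2 * q b := fun a => by simp [hs]
  have hN : (0 : ℝ) < #s := by
    exact_mod_cast card_pos.2 ⟨b, (hmem b).2 (by linarith [hq b])⟩
  have hbA : q b ≤ (∑ a ∈ s, q a) / #s := by
    rw [le_div_iff₀ hN, mul_comm, ← nsmul_eq_mul]
    exact card_nsmul_le_sum _ _ _ fun a _ => hb a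
  have hAb : (∑ a ∈ s, q a) / #s ≤ 2 * q b := by
    rw [div_le_iff₀ hN, mul_comm, ← nsmul_eq_mul]
    exact sum_le_card_nsmul _ _ _ fun a => (hmem a).1
  refine ⟨b, s, (∑ a ∈ s, q a) / #s, (hq b).trans hbA, fun a => ?_, fun a ha => ?_, fun a ha => ?_,
    neg_sum_mul_log_averageOn_le hq (fun a _ => hb a) fun a => (hmem a).1⟩
  · simp only [averageOn, hmem]
    split_ifs <;> linarith
  · by_contra! h
    simp [averageOn, hmem, h] at ha
  · simp only [averageOn, hmem]
    split_ifs <;> linarith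

end AverageOn

/-! ### Images of a mass vector -/

/-- The image of the mass vector `p` under `f`, that is, the vector of the masses of the fibres
of `f`; it is the law of `f(X)` when `p` is the law of `X`. -/
def push {ι F : Type*} [Fintype ι] [DecidableEq F] (p : ι → ℝ) (f : ι → F) (y : F) : ℝ :=
  ∑ i with f i = y, p i

section Push

variable {ι F : Type*} [Fintype ι] [DecidableEq F] {p : ι → ℝ}

theorem push_nonneg (hp : ∀ i, 0 ≤ p i) (f : ι → F) (y : F) : 0 ≤ push p f y :=
  sum_nonneg fun i _ => hp i

theorem sum_le_push (hp : ∀ i, 0 ≤ p i) {f : ι → F} {y : F} {s : Finset ι}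
    (hs : ∀ i ∈ s, f i = y) : ∑ i ∈ s, p i ≤ push p f y :=
  sum_le_sum_of_subset_of_nonneg (fun i hi => mem_filter.2 ⟨mem_univ i, hs i hi⟩) fun i _ _ => hp i

theorem le_push (hp : ∀ i, 0 ≤ p i) (f : ι → F) (i : ι) : p i ≤ push p f (f i) := by
  simpa using sum_le_push hp (f := f) (s := {i}) (by simp)

theorem sum_push_mul [Fintype F] (p : ι → ℝ) (f : ι → F) (g : F → ℝ) :
    ∑ y, push p f y * g y = ∑ i, p i * g (f i) := by
  rw [← sum_fiberwise univ f]
  refine sum_congr rfl fun y _ => ?_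
  rw [push, sum_mul]
  exact sum_congr rfl fun i hi => by rw [(mem_filter.1 hi).2]

theorem sum_push [Fintype F] (p : ι → ℝ) (f : ι → F) : ∑ y, push p f y = ∑ i, p i :=
  sum_fiberwise univ f p

theorem push_le_of_subsingleton {f : ι → F} {y : F} {c : ℝ} (hc : 0 ≤ c)
    (hpc : ∀ i, p i ≤ c) (hs : {i | f i = y ∧ 0 < p i}.Subsingleton) : push p f y ≤ c := by
  classical
  by_cases h : ∃ i, f i = y ∧ 0 < p i
  · obtain ⟨i, hi⟩ := h
    calc push p f y ≤ ∑ j with f j = y, if j = i then p i else 0 := sum_le_sum fun j hj => by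
          split_ifs with hji
          · rw [hji]
          · exact not_lt.1 fun hj0 => hji (hs ⟨(mem_filter.1 hj).2, hj0⟩ hi)
      _ = p i := by simp [hi.1]
      _ ≤ c := hpc i
  · push Not at h
    exact (sum_nonpos fun i hi => h i (mem_filter.1 hi).2).trans hc

theorem push_update [DecidableEq ι] (p : ι → ℝ) (f : ι → F) (i : ι) (b : F) :
    push p (update f i b) = push p f - Pi.single (f i) (p i) + Pi.single b (p i) := by
  funext y
  have hne : ∀ j ∈ univ.erase i, (if update f i b j = y then p j else 0) =
      if f j = y then p j else 0 := fun j hj => by rw [update_of_ne (ne_of_mem_erase hj)]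
  simp only [push, sum_filter, Pi.add_apply, Pi.sub_apply, Pi.single_apply]
  rw [← add_sum_erase _ _ (mem_univ i), ← add_sum_erase univ (fun j => if f j = y then p j else 0)
    (mem_univ i), sum_congr rfl hne, update_self]
  simp only [eq_comm (a := y)]
  ring

theorem push_equiv_comp {G : Type*} [DecidableEq G] (p : ι → ℝ) (f : ι → F) (e : F ≃ G) :
    push p (e ∘ f) = push p f ∘ e.symm := by
  funext y
  simp [push, Equiv.eq_symm_apply]

theorem push_comp_equiv {κ : Type*} [Fintype κ] (p : ι → ℝ) (f : ι → F) (e : κ ≃ ι) :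
    push (p ∘ e) (f ∘ e) = push p f := by
  funext y
  simp only [push, sum_filter, comp_apply]
  exact Equiv.sum_comp e fun i => if f i = y then p i else 0

end Push

theorem entropy_eq_sum_negMulLog {ι : Type*} [Fintype ι] (a : ι → ℝ) :
    entropy a = (∑ i, negMulLog (a i)) / log 2 := by
  simp only [entropy, logb, negMulLog, sum_div, ← sum_neg_distrib]
  exact sum_congr rfl fun i _ => by ring

theorem entropy_le_entropy_iff {ι κ : Type*} [Fintype ι] [Fintype κ] {a : ι → ℝ} {b : κ → ℝ} :
    entropy a ≤ entropy b ↔ ∑ i, negMulLog (a i) ≤ ∑ k, negMulLog (b k) := by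
  rw [entropy_eq_sum_negMulLog, entropy_eq_sum_negMulLog,
    div_le_div_iff_of_pos_right (log_pos one_lt_two)]

theorem entropy_comp_equiv {ι κ : Type*} [Fintype ι] [Fintype κ] (a : κ → ℝ) (e : ι ≃ κ) :
    entropy (a ∘ e) = entropy a :=
  congrArg Neg.neg (e.sum_comp fun k => a k * logb 2 (a k))

theorem image_entropy_push_comp_equiv {ι κ F : Type*} [Fintype ι] [Fintype κ] [Fintype F]
    [DecidableEq F] (p : ι → ℝ) (e : κ ≃ ι) :
    (fun g : κ → F => entropy (push (p ∘ e) g)) '' {g | Surjective g} =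
      (fun g : ι → F => entropy (push p g)) '' {g | Surjective g} := by
  refine Set.Subset.antisymm ?_ ?_
  · rintro _ ⟨g, hg, rfl⟩
    refine ⟨g ∘ e.symm, hg.comp e.symm.surjective, congrArg entropy ?_⟩
    rw [← push_comp_equiv p _ e, comp_assoc, e.symm_comp_self, comp_id]
  · rintro _ ⟨g, hg, rfl⟩
    exact ⟨g ∘ e, hg.comp e.surjective, congrArg entropy (push_comp_equiv p g e)⟩

section WaterLevel

variable {ι F : Type*} [Fintype ι] [Fintype F] {p : ι → ℝ} {f : ι → F} {c : ℝ}

/-- Otherwise moving the lighter of two atoms of the heavy fibre to the fibre of `b` would increase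
the entropy. -/
theorem subsingleton_of_two_mul_push_lt [DecidableEq F] (hp : ∀ i, 0 ≤ p i) (hf : Surjective f)
    (hmax : IsMaxOn (fun g => entropy (push p g)) {g | Surjective g} f) {b y : F}
    (hby : 2 * push p f b < push p f y) : {i | f i = y ∧ 0 < p i}.Subsingleton := by
  classical
  rintro i ⟨hiy, hi⟩ j ⟨hjy, hj⟩
  by_contra hne
  wlog hle : p i ≤ p j generalizing i j
  · exact this hjy hj hiy hi (Ne.symm hne) (le_of_not_ge hle)
  subst hiy
  have hb := push_nonneg hp f b
  have hneb : f i ≠ b := by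
    rintro rfl
    linarith
  have hpair : p i + p j ≤ push p f (f i) := by
    simpa [sum_pair hne] using sum_le_push hp (f := f) (s := {i, j}) (by simpa using hjy)
  have hsurj : Surjective (update f i b) := fun y => by
    obtain ⟨l, rfl⟩ := hf y
    rcases eq_or_ne l i with rfl | hl
    · exact ⟨j, by rw [update_of_ne (Ne.symm hne), hjy]⟩
    · exact ⟨l, update_of_ne hl _ _⟩
  have hloss : ∑ y, (negMulLog (push p (update f i b) y) - negMulLog (push p f y)) ≤ 0 := by
    rw [sum_sub_distrib, sub_nonpos]
    exact entropy_le_entropy_iff.1 (hmax hsurj)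
  rw [Fintype.sum_eq_add (f i) b hneb fun y hy => by simp [push_update, hy.1, hy.2]] at hloss
  have hgain := add_lt_add_of_strictConcaveOn strictConcaveOn_negMulLog (Set.mem_Ici.2
    (push_nonneg hp f (f i))) (Set.mem_Ici.2 hb) hi (by linarith)
  simp only [push_update, Pi.add_apply, Pi.sub_apply, Pi.single_eq_same,
    Pi.single_eq_of_ne hneb, Pi.single_eq_of_ne hneb.symm, add_zero, sub_zero] at hloss
  linarith

/-- `c` is the water level of `p` for `m` cells: the entries of `p` above `c` keep a cell each, and
the total mass of the other entries fills the remaining cells up to `c`. In terms of the paper,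
`c` is the common value of the last components of `R_m(p)`. The field `card_lt_le` excludes
vectors with more than `m` positive entries when `c = 0`. -/
structure IsWaterLevel (m : ℕ) (p : ι → ℝ) (c : ℝ) : Prop where
  nonneg : 0 ≤ c
  card_lt_le : #{i | c < p i} ≤ m
  sum_min : ∑ i, min (p i) c = m * c

theorem IsWaterLevel.sum_div_max_le {m : ℕ} (h : IsWaterLevel m p c) (hp : ∀ i, 0 ≤ p i) :
    ∑ i, p i / max (p i) c ≤ m := by
  rcases h.nonneg.eq_or_lt with rfl | hc
  · have hdiv : ∀ i, p i / max (p i) 0 = if 0 < p i then 1 else 0 := fun i => by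
      rcases (hp i).eq_or_lt with h0 | h0
      · simp [← h0]
      · rw [max_eq_left h0.le, div_self h0.ne', if_pos h0]
    simp only [hdiv, sum_boole]
    exact_mod_cast h.card_lt_le
  · have hdiv : ∀ i, p i / max (p i) c = min (p i) c / c := fun i => by
      rw [div_eq_div_iff (hc.trans_le (le_max_right _ _)).ne' hc.ne', min_mul_max]
    simp only [hdiv, ← sum_div, h.sum_min, mul_div_cancel_right₀ _ hc.ne', le_refl]

theorem IsWaterLevel.sum_max_comp_le (h : IsWaterLevel (Fintype.card F) p c) {a : F → ι}
    (ha : Injective a) : ∑ y, max (p (a y)) c ≤ ∑ i, p i := by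
  have htotal : ∑ i, (max (p i) c - c) = ∑ i, p i - Fintype.card F * c := by
    rw [← h.sum_min, ← sum_sub_distrib]
    exact sum_congr rfl fun i _ => by linarith [min_add_max (p i) c]
  have hsub : ∑ y, (max (p (a y)) c - c) ≤ ∑ i, (max (p i) c - c) := by
    simpa only [sum_map, Embedding.coeFn_mk] using sum_le_univ_sum_of_nonneg
      (s := univ.map ⟨a, ha⟩) (f := fun i => max (p i) c - c)
      fun i => sub_nonneg.2 (le_max_right _ _)
  rw [htotal, sum_sub_distrib, sum_const, card_univ, nsmul_eq_mul] at hsub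
  linarith

theorem IsWaterLevel.sum_negMulLog_push_le [DecidableEq F]
    (h : IsWaterLevel (Fintype.card F) p c)
    (hp : ∀ i, 0 ≤ p i) (hf : Surjective f) :
    ∑ y, negMulLog (push p f y) ≤ -∑ i, p i * log (max (p i) c) := by
  have hheaviest : ∀ y, ∃ a, f a = y ∧ ∀ i, f i = y → p i ≤ p a := fun y => by
    simpa using exists_max_image {i | f i = y} p ((hf y).imp fun i hi => by simpa using hi)
  choose a hfa hpa using hheaviest
  have hpos : ∀ y, 0 < push p f y → 0 < max (p (a y)) c := fun y hy => by
    by_contra! hle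
    exact hy.not_ge (sum_nonpos fun i hi =>
      ((hpa y i (mem_filter.1 hi).2).trans (le_max_left _ _)).trans hle)
  calc ∑ y, negMulLog (push p f y)
      ≤ -∑ y, push p f y * log (max (p (a y)) c) :=
        sum_negMulLog_le_neg_sum_mul_log (push_nonneg hp f)
          (fun y => h.nonneg.trans (le_max_right _ _)) hpos
          ((h.sum_max_comp_le (LeftInverse.injective hfa)).trans_eq (sum_push p f).symm)
    _ = -∑ i, p i * log (max (p (a (f i))) c) := by
        rw [sum_push_mul p f fun y => log (max (p (a y)) c)]
    _ ≤ -∑ i, p i * log (max (p i) c) := neg_le_neg <| sum_le_sum fun i _ => by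
        rcases (hp i).eq_or_lt with h0 | h0
        · simp [← h0]
        · exact mul_le_mul_of_nonneg_left (log_le_log (lt_max_of_lt_left h0)
            (max_le_max_right c (hpa _ i rfl))) h0.le

theorem IsWaterLevel.sum_mul_log_comp_le (h : IsWaterLevel (Fintype.card F) p c)
    (hp : ∀ i, 0 ≤ p i) {u : F → ℝ} {A : ℝ} (hA : 0 ≤ A) (hAu : ∀ y, A ≤ u y)
    (hfib : ∀ y, A < u y → {i | f i = y ∧ 0 < p i}.Subsingleton)
    (hpos : ∀ i, 0 < p i → 0 < u (f i)) (hsum : ∑ y, u y ≤ ∑ i, p i) :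
    ∑ i, p i * log (u (f i)) ≤ ∑ i, p i * log (max (p i) c) := by
  classical
  refine sum_mul_log_le_sum_mul_log hp hpos (fun i => lt_max_of_lt_left) ?_
  set d : ι → ℝ := fun i => p i / max (p i) c with hd
  have hd1 : ∀ i, d i ≤ 1 := fun i =>
    div_le_one_of_le₀ (le_max_left _ _) (h.nonneg.trans (le_max_right _ _))
  have hd0 : ∀ i, 0 < d i → 0 < p i := fun i hi =>
    (hp i).lt_of_ne fun h0 => by simp [hd, ← h0] at hi
  have hexcess : ∀ y, push d f y * (u y - A) ≤ u y - A := fun y => by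
    rcases (hAu y).eq_or_lt with hy | hy
    · simp [hy]
    · exact mul_le_of_le_one_left (sub_nonneg.2 hy.le) (push_le_of_subsingleton zero_le_one hd1
        ((hfib y hy).anti fun i hi => ⟨hi.1, hd0 i hi.2⟩))
  calc ∑ i, p i * (u (f i) / max (p i) c)
      = A * ∑ i, d i + ∑ i, d i * (u (f i) - A) := by
        rw [mul_sum, ← sum_add_distrib]
        exact sum_congr rfl fun i _ => by simp only [hd]; ring
    _ = A * ∑ i, d i + ∑ y, push d f y * (u y - A) := by rw [sum_push_mul d f fun y => u y - A]
    _ ≤ A * Fintype.card F + ∑ y, (u y - A) :=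
        add_le_add (mul_le_mul_of_nonneg_left (h.sum_div_max_le hp) hA)
          (sum_le_sum fun y _ => hexcess y)
    _ = ∑ y, u y := by
        rw [sum_sub_distrib, sum_const, card_univ, nsmul_eq_mul]
        ring
    _ ≤ ∑ i, p i := hsum

theorem IsWaterLevel.neg_sum_mul_log_max_le [DecidableEq F]
    (h : IsWaterLevel (Fintype.card F) p c)
    (hp : ∀ i, 0 ≤ p i) (hf : Surjective f)
    (hmax : IsMaxOn (fun g => entropy (push p g)) {g | Surjective g} f) :
    -∑ i, p i * log (max (p i) c) ≤
      ∑ y, negMulLog (push p f y) + (∑ i, p i) * (alpha * log 2) := by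
  cases isEmpty_or_nonempty ι
  · have := hf.isEmpty
    simp
  have := Nonempty.map f ‹_›
  obtain ⟨b, s, A, hA, hAu, hheavy, hpos, hcost⟩ := exists_averageOn_light (push_nonneg hp f)
  have hcompare := h.sum_mul_log_comp_le hp hA hAu
    (fun y hy => subsingleton_of_two_mul_push_lt hp hf hmax (hheavy y hy))
    (fun i hi => hpos _ (hi.trans_le (le_push hp f i)))
    (by rw [sum_averageOn, sum_push])
  rw [sum_push_mul p f fun y => log (averageOn s (push p f) y), sum_push] at hcost
  linarith

end WaterLevel

/-! ### The operator `R_m` -/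

section Coord

variable {n : ℕ} {p : Fin n → ℝ}

theorem coord_val_add_one (p : Fin n → ℝ) (i : Fin n) : coord p (i + 1) = p i := by
  simp [coord]

theorem coord_nonneg (hp : ∀ i, 0 ≤ p i) (j : ℕ) : 0 ≤ coord p j := by
  rw [coord]
  split_ifs
  exacts [hp _, le_rfl]

theorem antitone_coord_add_one (hanti : Antitone p) (hp : ∀ i, 0 ≤ p i) :
    Antitone fun j => coord p (j + 1) := fun j l hjl => by
  rcases lt_or_ge l n with hl | hl
  · have hle : p ⟨l, hl⟩ ≤ p ⟨j, hjl.trans_lt hl⟩ := hanti hjl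
    rwa [← coord_val_add_one p, ← coord_val_add_one p] at hle
  · have hzero : coord p (l + 1) = 0 := dif_neg (by lia)
    exact hzero.trans_le (coord_nonneg hp _)

theorem sum_range_coord_add_one (p : Fin n → ℝ) (g : ℝ → ℝ) :
    ∑ j ∈ range n, g (coord p (j + 1)) = ∑ i, g (p i) := by
  simp only [← Fin.sum_univ_eq_sum_range (fun j => g (coord p (j + 1))), coord_val_add_one]

theorem tailSum_eq_sum_Ico (p : Fin n → ℝ) (k : ℕ) :
    tailSum p k = ∑ j ∈ Ico k n, coord p (j + 1) := by
  rw [tailSum, sum_Ico_add' (coord p), ← Ico_add_one_right_eq_Icc]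

theorem tailSum_nonneg (hp : ∀ i, 0 ≤ p i) (k : ℕ) : 0 ≤ tailSum p k :=
  sum_nonneg fun j _ => coord_nonneg hp j

theorem tailSum_zero (p : Fin n → ℝ) : tailSum p 0 = ∑ i, p i := by
  rw [tailSum_eq_sum_Ico, ← range_eq_Ico, sum_range_coord_add_one p fun t => t]

theorem tailSum_eq_coord_add_tailSum (p : Fin n → ℝ) {k : ℕ} (h : k < n) :
    tailSum p k = coord p (k + 1) + tailSum p (k + 1) := by
  simp only [tailSum_eq_sum_Ico, sum_eq_sum_Ico_succ_bot h]

section Level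

variable {m k : ℕ} {c : ℝ}

theorem isWaterLevel_of_tailSum_eq (hkm : k ≤ m) (hkn : k ≤ n) (hc : 0 ≤ c)
    (hlow : ∀ j < k, c ≤ coord p (j + 1)) (hhigh : ∀ j, k ≤ j → coord p (j + 1) ≤ c)
    (htail : tailSum p k = (m - k) * c) : IsWaterLevel m p c where
  nonneg := hc
  card_lt_le := by
    have hsub : ({i | c < p i} : Finset (Fin n)) ⊆ ({i | (i : ℕ) < k} : Finset (Fin n)) := by
      intro i hi
      simp only [mem_filter_univ, ← coord_val_add_one p i] at hi ⊢
      exact not_le.1 fun h => hi.not_ge (hhigh i h)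
    calc #{i | c < p i} ≤ #{i : Fin n | (i : ℕ) < k} := card_le_card hsub
      _ = min n k := Fin.card_filter_val_lt
      _ ≤ m := (min_le_right _ _).trans hkm
  sum_min := by
    have hbelow : ∑ j ∈ range k, min (coord p (j + 1)) c = k * c := by
      rw [sum_congr rfl fun j hj => min_eq_right (hlow j (mem_range.1 hj)), sum_const, card_range,
        nsmul_eq_mul]
    have habove : ∑ j ∈ Ico k n, min (coord p (j + 1)) c = (m - k) * c := by
      rw [sum_congr rfl fun j hj => min_eq_left (hhigh j (mem_Ico.1 hj).1), ← tailSum_eq_sum_Ico,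
        htail]
    rw [← sum_range_coord_add_one p fun t => min t c, ← sum_range_add_sum_Ico _ hkn, hbelow, habove]
    ring

theorem sum_negMulLog_eq_neg_sum_mul_log_max (hkm : k ≤ m) (hkn : k ≤ n)
    (hlow : ∀ j < k, c ≤ coord p (j + 1)) (hhigh : ∀ j, k ≤ j → coord p (j + 1) ≤ c)
    (htail : tailSum p k = (m - k) * c) :
    ∑ j : Fin m, negMulLog (if (j : ℕ) < k then coord p (j + 1) else c) =
      -∑ i, p i * log (max (p i) c) := by
  have hbelow : ∀ j ∈ range k, negMulLog (if j < k then coord p (j + 1) else c) =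
      -(coord p (j + 1) * log (max (coord p (j + 1)) c)) := fun j hj => by
    rw [if_pos (mem_range.1 hj), max_eq_left (hlow j (mem_range.1 hj)), negMulLog, neg_mul]
  have hleft : ∑ j ∈ Ico k m, negMulLog (if j < k then coord p (j + 1) else c) =
      (m - k) * negMulLog c := by
    rw [sum_congr rfl fun j hj => by rw [if_neg (mem_Ico.1 hj).1.not_gt], sum_const, Nat.card_Ico,
      nsmul_eq_mul, Nat.cast_sub hkm]
  have hright : ∑ j ∈ Ico k n, coord p (j + 1) * log (max (coord p (j + 1)) c) =
      (m - k) * c * log c := by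
    rw [sum_congr rfl fun j hj => by rw [max_eq_right (hhigh j (mem_Ico.1 hj).1)], ← sum_mul,
      ← tailSum_eq_sum_Ico, htail]
  rw [Fin.sum_univ_eq_sum_range (fun j => negMulLog (if j < k then coord p (j + 1) else c)),
    ← sum_range_coord_add_one p fun t => t * log (max t c), ← sum_range_add_sum_Ico _ hkm,
    ← sum_range_add_sum_Ico _ hkn, sum_congr rfl hbelow, sum_neg_distrib, hleft, hright, negMulLog]
  ring

end Level

section CutIndex

variable {m : ℕ}

theorem cutIndex_lt (hm : 0 < m) (p : Fin n → ℝ) : cutIndex m p < m :=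
  (Nat.findGreatest_le _).trans_lt (Nat.sub_lt hm one_pos)

theorem tailSum_div_le_coord_of_lt_cutIndex (hanti : Antitone p) (hp : ∀ i, 0 ≤ p i) {j : ℕ}
    (hj : j < cutIndex m p) :
    tailSum p (cutIndex m p) / ((m : ℝ) - (cutIndex m p : ℝ)) ≤ coord p (j + 1) := by
  have hspec : tailSum p (cutIndex m p) / ((m : ℝ) - (cutIndex m p : ℝ)) ≤
      coord p (cutIndex m p) := Nat.findGreatest_of_ne_zero rfl (Nat.ne_zero_of_lt hj)
  have hle := antitone_coord_add_one hanti hp (Nat.le_sub_one_of_lt hj)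
  simp only [Nat.sub_add_cancel (Nat.one_le_of_lt hj)] at hle
  exact hspec.trans hle

theorem coord_cutIndex_add_one_le (hm : 0 < m) (hmn : m ≤ n) (hp : ∀ i, 0 ≤ p i) :
    coord p (cutIndex m p + 1) ≤ tailSum p (cutIndex m p) / ((m : ℝ) - (cutIndex m p : ℝ)) := by
  have hcut := cutIndex_lt hm p
  set k := cutIndex m p
  have hpos : (0 : ℝ) < m - k := sub_pos.2 (by exact_mod_cast hcut)
  rw [le_div_iff₀ hpos, tailSum_eq_coord_add_tailSum p (hcut.trans_le hmn)]
  rcases (Nat.succ_le_of_lt hcut).eq_or_lt with hlast | hlt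
  · have hone : (m : ℝ) - k = 1 := by
      rw [← hlast]
      push_cast
      ring
    rw [hone, mul_one]
    exact le_add_of_nonneg_right (tailSum_nonneg hp _)
  · have hnext : coord p (k + 1) < tailSum p (k + 1) / ((m : ℝ) - ((k + 1 : ℕ) : ℝ)) :=
      not_le.1 (Nat.findGreatest_is_greatest (Nat.lt_succ_self k) (Nat.le_sub_one_of_lt hlt))
    rw [lt_div_iff₀ (sub_pos.2 (by exact_mod_cast hlt))] at hnext
    push_cast at hnext
    linarith

theorem exists_isWaterLevel_flatten (hm : 0 < m) (hmn : m ≤ n) (hanti : Antitone p)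
    (hp : ∀ i, 0 ≤ p i) (hp1 : ∑ i, p i = 1) :
    ∃ c, IsWaterLevel m p c ∧
      ∑ j, negMulLog (flatten m p j) = -∑ i, p i * log (max (p i) c) := by
  suffices h : ∃ k c, k ≤ m ∧ 0 ≤ c ∧ (∀ j < k, c ≤ coord p (j + 1)) ∧ coord p (k + 1) ≤ c ∧
      tailSum p k = (m - k) * c ∧
      ∀ j : Fin m, flatten m p j = if (j : ℕ) < k then coord p (j + 1) else c by
    obtain ⟨k, c, hkm, hc, hlow, hhigh, htail, hflat⟩ := h
    have hhigh' : ∀ j, k ≤ j → coord p (j + 1) ≤ c := fun j hj =>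
      (antitone_coord_add_one hanti hp hj).trans hhigh
    simp only [hflat]
    exact ⟨c, isWaterLevel_of_tailSum_eq hkm (hkm.trans hmn) hc hlow hhigh' htail,
      sum_negMulLog_eq_neg_sum_mul_log_max hkm (hkm.trans hmn) hlow hhigh' htail⟩
  by_cases h1 : coord p 1 < 1 / (m : ℝ)
  · refine ⟨0, 1 / m, m.zero_le, by positivity, fun j hj => absurd hj j.not_lt_zero, h1.le, ?_,
      fun j => by rw [flatten, if_pos h1, if_neg (Nat.not_lt_zero _)]⟩
    rw [tailSum_zero, hp1, Nat.cast_zero, sub_zero,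
      mul_one_div_cancel (Nat.cast_ne_zero.2 hm.ne')]
  · have hcut := cutIndex_lt hm p
    have hpos : (0 : ℝ) < m - cutIndex m p := sub_pos.2 (by exact_mod_cast hcut)
    exact ⟨cutIndex m p, _, hcut.le, div_nonneg (tailSum_nonneg hp _) hpos.le,
      fun j => tailSum_div_le_coord_of_lt_cutIndex hanti hp, coord_cutIndex_add_one_le hm hmn hp,
      (mul_div_cancel₀ _ hpos.ne').symm,
      fun j => by simp only [flatten, if_neg h1, Nat.add_one_le_iff]⟩

end CutIndex

section Flatten

variable {F : Type*} [Fintype F] [Nonempty F] [DecidableEq F] {f : Fin n → F}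

theorem entropy_push_le_entropy_flatten (hanti : Antitone p) (hp : ∀ i, 0 ≤ p i)
    (hp1 : ∑ i, p i = 1) (hf : Surjective f) :
    entropy (push p f) ≤ entropy (flatten (Fintype.card F) p) := by
  have hmn := Fintype.card_fin n ▸ Fintype.card_le_of_surjective f hf
  obtain ⟨c, hc, hflat⟩ := exists_isWaterLevel_flatten Fintype.card_pos hmn hanti hp hp1
  exact entropy_le_entropy_iff.2 ((hc.sum_negMulLog_push_le hp hf).trans_eq hflat.symm)

theorem entropy_flatten_sub_alpha_le (hanti : Antitone p) (hp : ∀ i, 0 ≤ p i)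
    (hp1 : ∑ i, p i = 1) (hf : Surjective f)
    (hmax : IsMaxOn (fun g => entropy (push p g)) {g | Surjective g} f) :
    entropy (flatten (Fintype.card F) p) - alpha ≤ entropy (push p f) := by
  have hmn := Fintype.card_fin n ▸ Fintype.card_le_of_surjective f hf
  obtain ⟨c, hc, hflat⟩ := exists_isWaterLevel_flatten Fintype.card_pos hmn hanti hp hp1
  have hlog : 0 < log 2 := log_pos one_lt_two
  rw [entropy_eq_sum_negMulLog, entropy_eq_sum_negMulLog, sub_le_iff_le_add,
    div_add' _ _ _ hlog.ne', div_le_div_iff_of_pos_right hlog, hflat]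
  simpa only [hp1, one_mul] using hc.neg_sum_mul_log_max_le hp hf hmax

end Flatten

end Coord

/-! ### The operator `Q_m` -/

section MergeTop

variable {n m : ℕ} {p : Fin n → ℝ}

/-- The map that merges the first `n - m + 1` indices into `0` and is injective on the remaining
ones; it realizes `Q_m(p)` as an image of `p`. The truncated subtraction `i - (n - m)` is
intended. -/
def mergeMap (n m : ℕ) [NeZero m] (i : Fin n) : Fin m :=
  ⟨i - (n - m), by have := NeZero.pos m; lia⟩

theorem mergeMap_surjective [NeZero m] (hmn : m ≤ n) : Surjective (mergeMap n m) := fun j =>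
  ⟨⟨j + (n - m), by lia⟩, Fin.ext (Nat.add_sub_cancel _ _)⟩

theorem push_mergeMap [NeZero m] (p : Fin n → ℝ) (hmn : m ≤ n) :
    push p (mergeMap n m) = mergeTop m p := by
  funext k
  have hpush : push p (mergeMap n m) k =
      ∑ l ∈ range n with l - (n - m) = (k : ℕ), coord p (l + 1) := by
    rw [sum_filter, ← Fin.sum_univ_eq_sum_range
      (fun l => if l - (n - m) = (k : ℕ) then coord p (l + 1) else 0)]
    simp only [push, sum_filter, mergeMap, Fin.ext_iff, coord_val_add_one]
  rw [hpush, mergeTop]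
  have hm := NeZero.pos m
  split_ifs with hk
  · have hfilter : {l ∈ range n | l - (n - m) = (k : ℕ)} = Ico 0 (n - m + 1) := by
      ext l
      simp only [mem_filter, mem_range, mem_Ico]
      lia
    rw [hfilter, sum_Ico_add' (coord p), ← Ico_add_one_right_eq_Icc]
  · have hfilter : {l ∈ range n | l - (n - m) = (k : ℕ)} = {n - m + (k : ℕ)} := by
      ext l
      simp only [mem_filter, mem_range, mem_singleton]
      lia
    rw [hfilter, sum_singleton, add_assoc]

/-- Since `f` hits the `m - j` values `≥ j`, not all of their preimages are among the last
`m - j - 1` indices. -/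
theorem mergeTop_le_push (hanti : Antitone p) (hp : ∀ i, 0 ≤ p i) {f : Fin n → Fin m}
    (hf : Surjective f) (hpush : Antitone (push p f)) {j : Fin m} (hj : (j : ℕ) ≠ 0) :
    mergeTop m p j ≤ push p f j := by
  have hmn : m ≤ n := by simpa using Fintype.card_le_of_surjective f hf
  let b : Fin n := ⟨n - m + j, by lia⟩
  obtain ⟨i, hji, hib⟩ : ∃ i, j ≤ f i ∧ i ≤ b := by
    by_contra! h
    have hsurj : Set.SurjOn f (Ioi b) (Ici j) := fun y hy => by
      obtain ⟨i, rfl⟩ := hf y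
      exact ⟨i, by simpa using h i (by simpa using hy), rfl⟩
    have hcard := card_le_card_of_surjOn f hsurj
    simp only [Fin.card_Ici, Fin.card_Ioi, b] at hcard
    lia
  calc mergeTop m p j = p b := by
        rw [mergeTop, if_neg hj, ← add_assoc]
        exact coord_val_add_one p b
    _ ≤ p i := hanti hib
    _ ≤ push p f (f i) := le_push hp f i
    _ ≤ push p f j := hpush hji

theorem entropy_mergeTop_le_of_antitone (hanti : Antitone p) (hp : ∀ i, 0 ≤ p i)
    {f : Fin n → Fin m} (hf : Surjective f) (hpush : Antitone (push p f)) :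
    entropy (mergeTop m p) ≤ entropy (push p f) := by
  have hmn : m ≤ n := by simpa using Fintype.card_le_of_surjective f hf
  rcases Nat.eq_zero_or_pos m with rfl | hm
  · simp [entropy]
  have : NeZero m := ⟨hm.ne'⟩
  refine entropy_le_entropy_iff.2 (sum_negMulLog_le_of_le_of_ne (k₀ := 0) (push_nonneg hp f)
    (fun j => ?_) (fun j => hpush (Fin.zero_le j))
    (fun j hj => mergeTop_le_push hanti hp hf hpush (Fin.val_ne_zero_iff.2 hj)) ?_)
  · rw [← push_mergeMap p hmn]
    exact push_nonneg hp _ j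
  · rw [← push_mergeMap p hmn, sum_push, sum_push]

theorem exists_equiv_antitone_comp {F : Type*} [Fintype F] (q : F → ℝ) :
    ∃ e : Fin (Fintype.card F) ≃ F, Antitone (q ∘ e) :=
  let e := (Fintype.equivFin F).symm
  ⟨(Tuple.sort (OrderDual.toDual ∘ q ∘ e)).trans e, decr_antitone (q ∘ e)⟩

theorem isLeast_entropy_mergeTop {F : Type*} [Fintype F] [Nonempty F] [DecidableEq F]
    (hanti : Antitone p) (hp : ∀ i, 0 ≤ p i) (hmn : Fintype.card F ≤ n) :
    IsLeast ((fun g : Fin n → F => entropy (push p g)) '' {g | Surjective g})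
      (entropy (mergeTop (Fintype.card F) p)) := by
  refine ⟨?_, Set.forall_mem_image.2 fun g hg => ?_⟩
  · let e := (Fintype.equivFin F).symm
    refine ⟨e ∘ mergeMap n (Fintype.card F), e.surjective.comp (mergeMap_surjective hmn), ?_⟩
    simp only [push_equiv_comp, entropy_comp_equiv, push_mergeMap p hmn]
  · obtain ⟨e, he⟩ := exists_equiv_antitone_comp (push p g)
    have hpush : push p (e.symm ∘ g) = push p g ∘ e := push_equiv_comp p g e.symm
    calc entropy (mergeTop (Fintype.card F) p) ≤ entropy (push p (e.symm ∘ g)) :=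
          entropy_mergeTop_le_of_antitone hanti hp (e.symm.surjective.comp hg) (hpush ▸ he)
      _ = entropy (push p g) := by rw [hpush, entropy_comp_equiv]

end MergeTop

/-! ### Laws of functions of a random variable -/

section Law

open MeasureTheory

variable {Ω : Type*} [MeasurableSpace Ω] {P : Measure Ω} {E F : Type*} [Fintype E]
  [MeasurableSpace E] [MeasurableSingletonClass E] {X : Ω → E}

theorem law_comp_eq_push [IsFiniteMeasure P] [DecidableEq F] (hX : Measurable X) (f : E → F) :
    law P (f ∘ X) = push (law P X) f := by
  funext y
  simp only [law, push]
  rw [sum_measureReal_preimage_singleton _ fun e _ => hX (measurableSet_singleton e)]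
  congr 1
  ext ω
  simp

theorem sum_law [IsProbabilityMeasure P] (hX : Measurable X) : ∑ e, law P X e = 1 := by
  simp only [law]
  rw [sum_measureReal_preimage_singleton _ fun e _ => hX (measurableSet_singleton e)]
  simp

theorem imageEntropies_eq_image [IsFiniteMeasure P] [Fintype F] [DecidableEq F]
    (hX : Measurable X) :
    imageEntropies P X F = (fun g : E → F => entropy (push (law P X) g)) '' {g | Surjective g} := by
  ext h
  simp only [imageEntropies, law_comp_eq_push hX, Set.mem_ofPred_eq, Set.mem_image, eq_comm]

end Law

end EntropyOfFunction

theorem theorem1 {Ω : Type*} [MeasurableSpace Ω] (P : MeasureTheory.Measure Ω)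
    [MeasureTheory.IsProbabilityMeasure P]
    {E : Type*} [MeasurableSpace E] [MeasurableSingletonClass E]
    {F : Type*} [Fintype F]
    (n m : ℕ) (hm : 2 ≤ m) (hmn : m < n)
    (x : Fin n ≃ E) (hF : Fintype.card F = m)
    (X : Ω → E) (hX : Measurable X)
    (p : Fin n → ℝ) (hp : ∀ i, EntropyOfFunction.law P X (x i) = p i) :
    EntropyOfFunction.alpha < 0.0861 ∧
    (∃ M : ℝ, IsGreatest (EntropyOfFunction.imageEntropies P X F) M ∧
      M ∈ Set.Icc
        (EntropyOfFunction.entropy (EntropyOfFunction.flatten m (EntropyOfFunction.decr p))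
          - EntropyOfFunction.alpha)
        (EntropyOfFunction.entropy (EntropyOfFunction.flatten m (EntropyOfFunction.decr p)))) ∧
    IsLeast (EntropyOfFunction.imageEntropies P X F)
      (EntropyOfFunction.entropy
        (EntropyOfFunction.mergeTop m (EntropyOfFunction.decr p))) := by
  classical
  open EntropyOfFunction in
  subst hF
  have : Fintype E := Fintype.ofEquiv _ x
  have : Nonempty F := Fintype.card_pos_iff.1 (by lia)
  obtain rfl : law P X ∘ x = p := funext hp
  set σ := Tuple.sort (OrderDual.toDual ∘ law P X ∘ x)
  have hdecr : decr (law P X ∘ x) = law P X ∘ σ.trans x := rfl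
  have hanti := decr_antitone (law P X ∘ x)
  have hpos : ∀ i, 0 ≤ decr (law P X ∘ x) i := fun _ => MeasureTheory.measureReal_nonneg
  have hsum : ∑ i, decr (law P X ∘ x) i = 1 := by
    rw [hdecr, ← sum_law (P := P) hX]
    exact (σ.trans x).sum_comp (law P X)
  have himage := imageEntropies_eq_image (P := P) (F := F) hX
  rw [← image_entropy_push_comp_equiv (law P X) (σ.trans x), ← hdecr] at himage
  have hmin := isLeast_entropy_mergeTop (F := F) hanti hpos hmn.le
  obtain ⟨f, hf, hmax⟩ := Set.exists_max_image {g : Fin n → F | Function.Surjective g}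
    (fun g => entropy (push (decr (law P X ∘ x)) g)) (Set.toFinite _)
    (Set.image_nonempty.1 hmin.nonempty)
  rw [himage]
  exact ⟨alpha_lt, ⟨_, ⟨Set.mem_image_of_mem _ hf, Set.forall_mem_image.2 hmax⟩,
    entropy_flatten_sub_alpha_le hanti hpos hsum hf hmax,
    entropy_push_le_entropy_flatten hanti hpos hsum hf⟩, hmin⟩
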